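/- For $\lambda\in\mathbb R$ let $e_\lambda(x)=e^{i\lambda x}$, $x\in\mathbb R$, and let $AP$ be the algebra of uniformly almost periodic functions, i.e. the smallest closed subalgebra of $L^\infty(\mathbb R)$ containing all $e_\lambda$, $\lambda\in\mathbb R$. Let $AP^0\subset AP$ be the set of finite sums $\sum_j r_je_{\lambda_j}$ with $r_j\in\mathbb C$, $\lambda_j\in\mathbb R$. The Bohr–Fourier spectrum of $a\in AP$ is $$\Omega(a)=\Big\{\lambda\in\mathbb R:\ \lim_{N\to\infty}\frac1{2N}\int_{-N}^{N}a(x)e_{-\lambda}(x)\,dx\neq0\Big\}.$$ Let $\Sigma\subset[0,\infty)$ be an additive semigroup containing $0$, let $AP_\Sigma^0=\{a\in AP^0:\Omega(a)\subset\Sigma\}$, and let the Banach algebra $AP_\Sigma$ be the closure of $AP_\Sigma^0$ in $AP$. Let $M(AP_\Sigma)$ be the maximal ideal space of $AP_\Sigma$, i.e. the space of nonzero homomorphisms $AP_\Sigma\to\mathbb C$ with the weak$^*$ (Gelfand) topology. Then for every integer $m\ge1$ the Čech cohomology group $H^m(M(AP_\Sigma),\mathbb Z)$ is trivial. (Here the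 Čech cohomology of a space is the direct limit, over all open covers directed by refinement, of the simplicial cohomology groups of the nerves of the covers.) -/

import Mathlib

open Filter Topology MeasureTheory TopologicalSpace BoundedContinuousFunction
open scoped ENNReal

/-! ## Almost periodic functions and the algebras attached to a semigroup of frequencies

Bounded continuous functions on the real line embed isometrically into `L^∞(ℝ)`
(`eLpNorm_top_eq_enorm` below) and form a complete, hence closed, subalgebra of it which contains
all the exponentials. So the smallest closed subalgebra of `L^∞(ℝ)` containing the exponentials
can be, and is here, formed inside `ℝ →ᵇ ℂ` with the supremum norm. -/

/-- The essential supremum norm of a bounded continuous function is its supremum norm. -/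
theorem eLpNorm_top_eq_enorm (f : ℝ →ᵇ ℂ) :
    eLpNorm f ∞ (volume : Measure ℝ) = ‖f‖ₑ := by
  rw [eLpNorm_exponent_top]
  apply le_antisymm
  · refine eLpNormEssSup_le_of_ae_enorm_bound (Eventually.of_forall fun x => ?_)
    rw [enorm_le_iff_norm_le]
    exact f.norm_coe_le_norm x
  · have h1 : ∀ x, ‖f x‖ₑ ≤ eLpNormEssSup f (volume : Measure ℝ) := by
      have h0 := enorm_ae_le_eLpNormEssSup f (volume : Measure ℝ)
      have ho : IsOpen {x | ¬ ‖f x‖ₑ ≤ eLpNormEssSup f (volume : Measure ℝ)} := by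
        simp only [not_le]
        exact isOpen_lt continuous_const f.continuous.enorm
      have he := (ho.measure_eq_zero_iff (μ := (volume : Measure ℝ))).1 (ae_iff.1 h0)
      intro x
      by_contra hx
      have : x ∈ (∅ : Set ℝ) := he ▸ hx
      exact this
    by_cases ht : eLpNormEssSup f (volume : Measure ℝ) = ∞
    · simp [ht]
    · have : ‖f‖ ≤ (eLpNormEssSup f (volume : Measure ℝ)).toReal := by
        refine (BoundedContinuousFunction.norm_le ENNReal.toReal_nonneg).2 fun x => ?_
        have := ENNReal.toReal_mono ht (h1 x)
        simpa using this
      rw [← ofReal_norm]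
      exact ENNReal.ofReal_le_of_le_toReal this

/-- The exponential `e_λ(x) = exp(i λ x)` as a bounded continuous function on the real line. -/
noncomputable def apExp (l : ℝ) : ℝ →ᵇ ℂ :=
  BoundedContinuousFunction.ofNormedAddCommGroup
    (fun x : ℝ => Complex.exp (Complex.I * l * x)) (by fun_prop) 1 (by
      intro x
      have : Complex.I * l * x = ((l * x : ℝ) : ℂ) * Complex.I := by push_cast; ring
      rw [this, Complex.norm_exp_ofReal_mul_I])

@[simp] theorem apExp_apply (l x : ℝ) : apExp l x = Complex.exp (Complex.I * l * x) := rfl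

/-- The algebra `AP` of uniformly almost periodic functions: the smallest closed subalgebra
containing all the exponentials. -/
noncomputable def almostPeriodic : Subalgebra ℂ (ℝ →ᵇ ℂ) :=
  (Algebra.adjoin ℂ (Set.range apExp)).topologicalClosure

/-- The space `AP⁰` of almost periodic polynomials: finite sums `∑ r_j e_{λ_j}`. -/
noncomputable def apPolynomials : Submodule ℂ (ℝ →ᵇ ℂ) :=
  Submodule.span ℂ (Set.range apExp)

/-- The averages whose limit as `N → ∞` is the Bohr-Fourier coefficient of `a` at `l`. -/
noncomputable def bohrMean (a : ℝ →ᵇ ℂ) (l N : ℝ) : ℂ :=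
  (1 / (2 * N) : ℝ) * ∫ x in (-N)..N, a x * apExp (-l) x

/-- The Bohr-Fourier spectrum `Ω(a)`: the frequencies at which the limit
`lim_{N → ∞} (1 / 2N) ∫_{-N}^{N} a(x) e_{-λ}(x) dx` is nonzero. -/
def bohrSpectrum (a : ℝ →ᵇ ℂ) : Set ℝ :=
  {l | ∃ c : ℂ, c ≠ 0 ∧ Tendsto (bohrMean a l) atTop (𝓝 c)}

/-- The set `AP⁰_Σ` of almost periodic polynomials with spectrum in `Σ`. -/
def apPolynomialsOn (S : Set ℝ) : Set (ℝ →ᵇ ℂ) :=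
  {a | a ∈ apPolynomials ∧ bohrSpectrum a ⊆ S}

theorem bohrMean_apExp (k l : ℝ) :
    Tendsto (bohrMean (apExp k) l) atTop (𝓝 (if k = l then 1 else 0)) := by
  have hmul : ∀ x : ℝ, apExp k x * apExp (-l) x = Complex.exp ((Complex.I * (k - l)) * x) := by
    intro x
    rw [apExp_apply, apExp_apply, ← Complex.exp_add]
    congr 1
    push_cast
    ring
  unfold bohrMean
  simp only [hmul]
  split_ifs with h
  · subst h
    refine tendsto_const_nhds.congr' ?_
    filter_upwards [eventually_gt_atTop 0] with N hN
    have hN' : (N : ℂ) ≠ 0 := by exact_mod_cast hN.ne'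
    simp
    field_simp
    norm_num
  · have hkl : (Complex.I * (k - l) : ℂ) ≠ 0 := by
      refine mul_ne_zero Complex.I_ne_zero ?_
      exact_mod_cast sub_ne_zero.2 h
    simp only [integral_exp_mul_complex hkl]
    rw [tendsto_zero_iff_norm_tendsto_zero]
    have hlim : Tendsto (fun N : ℝ => N⁻¹ * ‖(Complex.I * (k - l) : ℂ)‖⁻¹) atTop (𝓝 0) := by
      simpa using tendsto_inv_atTop_zero.mul_const (‖(Complex.I * (k - l) : ℂ)‖⁻¹)
    refine tendsto_of_tendsto_of_tendsto_of_le_of_le' tendsto_const_nhds hlim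
      (Eventually.of_forall fun N => norm_nonneg _) ?_
    filter_upwards [eventually_gt_atTop 0] with N hN
    have hb : ∀ y : ℝ, ‖Complex.exp (Complex.I * (k - l) * y)‖ = 1 := by
      intro y
      have : Complex.I * (k - l) * y = (((k - l) * y : ℝ) : ℂ) * Complex.I := by
        push_cast; ring
      rw [this, Complex.norm_exp_ofReal_mul_I]
    have hd := norm_sub_le (Complex.exp (Complex.I * (k - l) * N))
      (Complex.exp (Complex.I * (k - l) * (-N : ℝ)))
    rw [hb, hb] at hd
    rw [norm_mul, norm_div, Complex.norm_real, Real.norm_of_nonneg (by positivity)]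
    have hpos : 0 < ‖(Complex.I * (k - l) : ℂ)‖ := norm_pos_iff.2 hkl
    calc _ ≤ 1 / (2 * N) * ((1 + 1) / ‖(Complex.I * (k - l) : ℂ)‖) := by gcongr
      _ = _ := by field_simp; norm_num

theorem bohrMean_linearCombination (f : ℝ →₀ ℂ) (l : ℝ) :
    Tendsto (bohrMean (Finsupp.linearCombination ℂ apExp f) l) atTop (𝓝 (f l)) := by
  have hcont : ∀ (a : ℝ →ᵇ ℂ) (N : ℝ),
      IntervalIntegrable (fun x => a x * apExp (-l) x) volume (-N) N := fun a N =>
    (a.continuous.mul (apExp (-l)).continuous).intervalIntegrable _ _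
  induction f using Finsupp.induction_linear with
  | zero =>
    have : bohrMean (Finsupp.linearCombination ℂ apExp (0 : ℝ →₀ ℂ)) l = fun _ => 0 := by
      funext N
      simp [bohrMean]
    rw [this]
    exact tendsto_const_nhds
  | add f g hf hg =>
    have : bohrMean (Finsupp.linearCombination ℂ apExp (f + g)) l =
        fun N => bohrMean (Finsupp.linearCombination ℂ apExp f) l N
          + bohrMean (Finsupp.linearCombination ℂ apExp g) l N := by
      funext N
      unfold bohrMean
      rw [← mul_add, ← intervalIntegral.integral_add (hcont _ N) (hcont _ N), map_add]
      simp only [BoundedContinuousFunction.coe_add, Pi.add_apply, add_mul]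
    rw [this, Finsupp.add_apply]
    exact hf.add hg
  | single k r =>
    have : bohrMean (Finsupp.linearCombination ℂ apExp (Finsupp.single k r)) l =
        fun N => r * bohrMean (apExp k) l N := by
      funext N
      unfold bohrMean
      rw [Finsupp.linearCombination_single]
      simp only [BoundedContinuousFunction.coe_smul, smul_eq_mul, mul_assoc]
      rw [intervalIntegral.integral_const_mul]
      ring
    rw [this]
    have h := (bohrMean_apExp k l).const_mul r
    convert h using 2
    by_cases hk : k = l <;> simp [hk]

theorem apPolynomialsOn_eq_span (S : Set ℝ) :
    apPolynomialsOn S = (Submodule.span ℂ (apExp '' S) : Set (ℝ →ᵇ ℂ)) := by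
  ext a
  rw [SetLike.mem_coe, Finsupp.mem_span_image_iff_linearCombination]
  constructor
  · rintro ⟨ha, hS⟩
    obtain ⟨f, rfl⟩ := (Finsupp.mem_span_range_iff_exists_finsupp).1 ha
    refine ⟨f, ?_, rfl⟩
    rw [Finsupp.mem_supported]
    intro l hl
    exact hS ⟨f l, Finsupp.mem_support_iff.1 hl, bohrMean_linearCombination f l⟩
  · rintro ⟨f, hf, rfl⟩
    refine ⟨(Finsupp.mem_span_range_iff_exists_finsupp).2 ⟨f, rfl⟩, ?_⟩
    rintro l ⟨c, hc, hlim⟩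
    have := tendsto_nhds_unique hlim (bohrMean_linearCombination f l)
    exact (Finsupp.mem_supported ℂ f).1 hf (Finsupp.mem_support_iff.2 (this ▸ hc))

theorem apExp_zero : apExp 0 = 1 := by
  ext x
  simp

theorem apExp_mul (k l : ℝ) : apExp k * apExp l = apExp (k + l) := by
  ext x
  rw [BoundedContinuousFunction.coe_mul, Pi.mul_apply, apExp_apply, apExp_apply, apExp_apply,
    ← Complex.exp_add]
  congr 1
  push_cast
  ring

theorem span_apExp_mul_mem (S : AddSubmonoid ℝ) {a b : ℝ →ᵇ ℂ}
    (ha : a ∈ Submodule.span ℂ (apExp '' (S : Set ℝ)))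
    (hb : b ∈ Submodule.span ℂ (apExp '' (S : Set ℝ))) :
    a * b ∈ Submodule.span ℂ (apExp '' (S : Set ℝ)) := by
  have h := Submodule.mul_mem_mul ha hb
  rw [Submodule.span_mul_span] at h
  refine Submodule.span_mono ?_ h
  rintro _ ⟨_, ⟨k, hk, rfl⟩, _, ⟨l, hl, rfl⟩, rfl⟩
  exact ⟨k + l, S.add_mem hk hl, (apExp_mul k l).symm⟩

/-- `AP⁰_Σ` is a subalgebra when `Σ` is an additive semigroup containing `0`. -/
noncomputable def apPolynomialAlgebra (S : AddSubmonoid ℝ) : Subalgebra ℂ (ℝ →ᵇ ℂ) where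
  carrier := apPolynomialsOn S
  mul_mem' := by
    intro a b ha hb
    rw [apPolynomialsOn_eq_span] at *
    exact span_apExp_mul_mem S ha hb
  add_mem' := by
    intro a b ha hb
    rw [apPolynomialsOn_eq_span] at *
    exact Submodule.add_mem _ ha hb
  algebraMap_mem' := by
    intro r
    rw [apPolynomialsOn_eq_span, Algebra.algebraMap_eq_smul_one, ← apExp_zero]
    exact Submodule.smul_mem _ r (Submodule.subset_span ⟨0, S.zero_mem, rfl⟩)

/-- The Banach algebra `AP_Σ`: the closure of `AP⁰_Σ`. -/
noncomputable def apAlgebra (S : AddSubmonoid ℝ) : Subalgebra ℂ (ℝ →ᵇ ℂ) :=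
  (apPolynomialAlgebra S).topologicalClosure

/-- `AP_Σ` consists of almost periodic functions, so (`AP` being closed) it does not matter whether
the closure is taken in `AP` or in the bounded continuous functions. -/
theorem apAlgebra_le_almostPeriodic (S : AddSubmonoid ℝ) : apAlgebra S ≤ almostPeriodic := by
  refine closure_mono fun a ha => ?_
  exact Algebra.span_le_adjoin ℂ _ ha.1

/-- The maximal ideal space `M(AP_Σ)`: nonzero (continuous) homomorphisms `AP_Σ → ℂ` with the
weak-* topology. -/
abbrev apMaximalIdealSpace (S : AddSubmonoid ℝ) : Type :=
  WeakDual.characterSpace ℂ (apAlgebra S)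

/-! ## Čech cohomology

The Čech cohomology groups of a space are the direct limit, over all open covers directed by
refinement, of the simplicial cohomology groups of the nerves of the covers. -/

namespace Cech

universe u v

/-- An open cover of a topological space. -/
structure OpenCover (X : Type u) [TopologicalSpace X] where
  /-- the members of the cover -/
  sets : Set (Opens X)
  exists_mem : ∀ x : X, ∃ u ∈ sets, x ∈ u

section

variable {X : Type u} [TopologicalSpace X] {A : Type v} [AddCommGroup A]

/-- The order by refinement: `U ≤ V` if every member of `V` is contained in a member of `U`. -/
instance : Preorder (OpenCover X) where
  le U V := ∀ v : V.sets, ∃ u : U.sets, v.1 ≤ u.1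
  le_refl U v := ⟨v, le_rfl⟩
  le_trans U V W h₁ h₂ w := by
    obtain ⟨v, hv⟩ := h₂ w
    obtain ⟨u, hu⟩ := h₁ v
    exact ⟨u, hv.trans hu⟩

instance : Nonempty (OpenCover X) :=
  ⟨⟨Set.univ, fun _ => ⟨⊤, trivial, trivial⟩⟩⟩

instance : IsDirectedOrder (OpenCover X) where
  directed U V := by
    refine ⟨⟨{w | ∃ u ∈ U.sets, ∃ v ∈ V.sets, w = u ⊓ v}, fun x => ?_⟩, ?_, ?_⟩
    · obtain ⟨u, hu, hxu⟩ := U.exists_mem x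
      obtain ⟨v, hv, hxv⟩ := V.exists_mem x
      exact ⟨u ⊓ v, ⟨u, hu, v, hv, rfl⟩, hxu, hxv⟩
    · rintro ⟨w, u, hu, v, hv, rfl⟩
      exact ⟨⟨u, hu⟩, inf_le_left⟩
    · rintro ⟨w, u, hu, v, hv, rfl⟩
      exact ⟨⟨v, hv⟩, inf_le_right⟩

/-- The (ordered, possibly degenerate) `n`-simplices of the nerve of a cover: `(n+1)`-tuples of
members of the cover with nonempty intersection. -/
def Simplex (U : OpenCover X) (n : ℕ) : Type u :=
  {σ : Fin (n + 1) → U.sets // ∃ x : X, ∀ i, x ∈ (σ i).1}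

/-- The `i`-th face of a simplex. -/
def Simplex.face {U : OpenCover X} {n : ℕ} (σ : Simplex U (n + 1)) (i : Fin (n + 2)) :
    Simplex U n :=
  ⟨fun j => σ.1 (i.succAbove j), σ.2.imp fun _ hx _ => hx _⟩

/-- The coboundary `(δ c)(σ) = ∑ᵢ (-1)ⁱ c(∂ᵢ σ)` on the cochains of the nerve. -/
def coboundary (U : OpenCover X) (A : Type v) [AddCommGroup A] (n : ℕ) :
    (Simplex U n → A) →+ (Simplex U (n + 1) → A) where
  toFun c σ := ∑ i : Fin (n + 2), (-1 : ℤ) ^ (i : ℕ) • c (σ.face i)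
  map_zero' := by
    funext σ
    simp
  map_add' c c' := by
    funext σ
    simp [smul_add, Finset.sum_add_distrib]

/-- Cocycles of the nerve. -/
def cocycles (U : OpenCover X) (A : Type v) [AddCommGroup A] (n : ℕ) :
    AddSubgroup (Simplex U n → A) :=
  (coboundary U A n).ker

/-- Coboundaries of the nerve. -/
def coboundaries (U : OpenCover X) (A : Type v) [AddCommGroup A] :
    (n : ℕ) → AddSubgroup (Simplex U n → A)
  | 0 => ⊥
  | n + 1 => (coboundary U A n).range

/-- The cohomology `ker δ / im δ` of the nerve of a cover. -/
abbrev NerveCohomology (U : OpenCover X) (A : Type v) [AddCommGroup A] (n : ℕ) : Type (max u v) :=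
  cocycles U A n ⧸ (coboundaries U A n).addSubgroupOf (cocycles U A n)

/-! ### Computations with cochains on all tuples -/

section Tuples

variable {I J : Type*}

/-- The coboundary of a function on all tuples. -/
def tupleD {m : ℕ} (c : (Fin m → I) → A) : (Fin (m + 1) → I) → A :=
  fun σ => ∑ i : Fin (m + 1), (-1 : ℤ) ^ (i : ℕ) • c (fun j => σ (i.succAbove j))

theorem tupleD_cons {m : ℕ} (c : (Fin (m + 1) → I) → A) (a : I) (σ : Fin (m + 1) → I) :
    tupleD c (Fin.cons a σ) = c σ - tupleD (fun τ => c (Fin.cons a τ)) σ := by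
  unfold tupleD
  rw [Fin.sum_univ_succ, sub_eq_add_neg, ← Finset.sum_neg_distrib]
  congr 1
  · simp
  · refine Finset.sum_congr rfl fun i _ => ?_
    have : (fun j : Fin (m + 1) =>
        (Fin.cons a σ : Fin (m + 2) → I) (i.succ.succAbove j)) =
        (Fin.cons a (fun j => σ (i.succAbove j)) : Fin (m + 1) → I) := by
      funext j
      refine Fin.cases ?_ (fun j => ?_) j <;> simp
    rw [this, Fin.val_succ, pow_succ]
    simp

theorem tupleD_zero {c : (Fin 0 → I) → A} (σ : Fin 1 → I) (τ : Fin 0 → I) :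
    tupleD c σ = c τ := by
  simp only [tupleD, Fin.sum_univ_succ, Finset.univ_eq_empty, Finset.sum_empty]
  simp only [Fin.val_zero, pow_zero, one_smul, add_zero]
  exact congrArg c (Subsingleton.elim _ _)

theorem tupleD_sub {m : ℕ} (c c' : (Fin m → I) → A) (σ : Fin (m + 1) → I) :
    tupleD (fun τ => c τ - c' τ) σ = tupleD c σ - tupleD c' σ := by
  simp [tupleD, smul_sub, Finset.sum_sub_distrib]

theorem tupleD_tupleD {m : ℕ} (c : (Fin m → I) → A) (σ : Fin (m + 2) → I) :
    tupleD (tupleD c) σ = 0 := by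
  induction m with
  | zero =>
    obtain ⟨a, τ, rfl⟩ : ∃ a τ, σ = Fin.cons a τ := ⟨_, _, (Fin.cons_self_tail σ).symm⟩
    rw [tupleD_cons, tupleD_zero τ Fin.elim0, tupleD_zero τ Fin.elim0,
      tupleD_zero _ Fin.elim0, sub_self]
  | succ m ih =>
    obtain ⟨a, τ, rfl⟩ : ∃ a τ, σ = Fin.cons a τ := ⟨_, _, (Fin.cons_self_tail σ).symm⟩
    rw [tupleD_cons]
    simp only [tupleD_cons]
    rw [tupleD_sub, ih]
    simp

/-- The prism operator of two vertex maps `f` and `g`. -/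
def tuplePrism (f g : J → I) : {m : ℕ} → ((Fin (m + 1) → I) → A) → (Fin m → J) → A
  | 0, _, _ => 0
  | _ + 1, c, σ =>
    c (Fin.cons (f (σ 0)) (fun j => g (σ j)))
      - tuplePrism f g (fun τ => c (Fin.cons (f (σ 0)) τ)) (Fin.tail σ)

theorem tuplePrism_cons (f g : J → I) {m : ℕ} (c : (Fin (m + 2) → I) → A) (a : J)
    (σ : Fin m → J) :
    tuplePrism f g c (Fin.cons a σ) =
      c (Fin.cons (f a) (Fin.cons (g a) (fun j => g (σ j))))
        - tuplePrism f g (fun τ => c (Fin.cons (f a) τ)) σ := by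
  have : (fun j : Fin (m + 1) => g ((Fin.cons a σ : Fin (m + 1) → J) j)) =
      (Fin.cons (g a) (fun j => g (σ j)) : Fin (m + 1) → I) := by
    funext j
    refine Fin.cases ?_ (fun j => ?_) j <;> simp
  simp [tuplePrism, this]

theorem tuplePrism_sub (f g : J → I) {m : ℕ} (c c' : (Fin (m + 1) → I) → A) (σ : Fin m → J) :
    tuplePrism f g (fun τ => c τ - c' τ) σ = tuplePrism f g c σ - tuplePrism f g c' σ := by
  induction m with
  | zero => simp [tuplePrism]
  | succ m ih =>
    simp only [tuplePrism]
    rw [ih]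
    abel

/-- The prism operator only sees tuples made of the `f`- and `g`-images of the vertices. -/
theorem tuplePrism_eq_zero (f g : J → I) {m : ℕ} (c : (Fin (m + 1) → I) → A) (σ : Fin m → J)
    (h : ∀ τ, (∀ i, ∃ j, τ i = f (σ j) ∨ τ i = g (σ j)) → c τ = 0) :
    tuplePrism f g c σ = 0 := by
  induction m with
  | zero => rfl
  | succ m ih =>
    simp only [tuplePrism]
    rw [h, ih, sub_zero]
    · intro τ hτ
      refine h _ fun i => ?_
      refine Fin.cases ⟨0, Or.inl (by simp)⟩ (fun i => ?_) i
      obtain ⟨j, hj⟩ := hτ i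
      exact ⟨j.succ, by simpa [Fin.tail] using hj⟩
    · intro i
      refine Fin.cases ⟨0, Or.inl (by simp)⟩ (fun i => ?_) i
      exact ⟨i, Or.inr (by simp)⟩

theorem tuplePrism_homotopy (f g : J → I) {m : ℕ} (c : (Fin (m + 1) → I) → A)
    (σ : Fin (m + 1) → J) :
    tupleD (tuplePrism f g c) σ + tuplePrism f g (tupleD c) σ =
      c (fun j => g (σ j)) - c (fun j => f (σ j)) := by
  have hcons : ∀ {n : ℕ} (k : J → I) (a : J) (τ : Fin n → J),
      (fun j : Fin (n + 1) => k ((Fin.cons a τ : Fin (n + 1) → J) j)) =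
      (Fin.cons (k a) (fun j => k (τ j)) : Fin (n + 1) → I) := by
    intro n k a τ
    funext j
    refine Fin.cases ?_ (fun j => ?_) j <;> simp
  induction m with
  | zero =>
    obtain ⟨a, τ, rfl⟩ : ∃ a τ, σ = Fin.cons a τ := ⟨_, _, (Fin.cons_self_tail σ).symm⟩
    rw [tupleD_zero _ τ, tuplePrism_cons, tupleD_cons, hcons, hcons, tupleD_zero _ Fin.elim0]
    simp only [tuplePrism]
    simp only [Subsingleton.elim _ (Fin.elim0 : Fin 0 → I)]
    abel
  | succ m ih =>
    obtain ⟨a, τ, rfl⟩ : ∃ a τ, σ = Fin.cons a τ := ⟨_, _, (Fin.cons_self_tail σ).symm⟩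
    have h := ih (fun τ => c (Fin.cons (f a) τ)) τ
    rw [tupleD_cons, tuplePrism_cons, tupleD_cons, hcons, hcons, tupleD_cons]
    simp only [tuplePrism_cons, tupleD_cons]
    rw [tupleD_sub, tuplePrism_sub]
    have hg : tupleD (fun ρ : Fin m → J =>
          c (Fin.cons (f a) (Fin.cons (g a) (fun j => g (ρ j))))) τ =
        tupleD (fun ρ : Fin m → I => c (Fin.cons (f a) (Fin.cons (g a) ρ)))
          (fun j => g (τ j)) := rfl
    rw [hg]
    rw [← sub_eq_zero] at h ⊢
    rw [← h]
    abel

end Tuples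

theorem coboundary_coboundary (U : OpenCover X) (n : ℕ) (c : Simplex U n → A) :
    coboundary U A (n + 1) (coboundary U A n c) = 0 := by
  classical
  let e : (Fin (n + 1) → U.sets) → A :=
    fun τ => if h : ∃ x : X, ∀ i, x ∈ (τ i).1 then c ⟨τ, h⟩ else 0
  have he : ∀ σ : Simplex U n, e σ.1 = c σ := fun σ => dif_pos σ.2
  funext σ
  have := tupleD_tupleD e σ.1
  rw [Pi.zero_apply, ← this]
  simp only [coboundary, AddMonoidHom.coe_mk, ZeroHom.coe_mk, tupleD, ← he]
  rfl

theorem coboundaries_le_cocycles (U : OpenCover X) (A : Type v) [AddCommGroup A] (n : ℕ) :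
    coboundaries U A n ≤ cocycles U A n := by
  cases n with
  | zero => exact bot_le
  | succ n =>
    rintro _ ⟨c, rfl⟩
    exact coboundary_coboundary U n c

/-! ### Simplicial maps of nerves -/

/-- A map on vertices which carries simplices of nerves to simplices: sets with a common point go
to sets with a common point. -/
def IsSimplicial {U V : OpenCover X} (f : V.sets → U.sets) : Prop :=
  ∀ x : X, ∃ y : X, ∀ v : V.sets, x ∈ v.1 → y ∈ (f v).1

/-- The image of a simplex under a simplicial map. -/
def Simplex.map {U V : OpenCover X} {f : V.sets → U.sets} (hf : IsSimplicial f) {n : ℕ}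
    (σ : Simplex V n) : Simplex U n :=
  ⟨fun j => f (σ.1 j), by
    obtain ⟨x, hx⟩ := σ.2
    exact (hf x).imp fun y hy j => hy _ (hx j)⟩

/-- Pullback of cochains. -/
def cochainMap {U V : OpenCover X} {f : V.sets → U.sets} (hf : IsSimplicial f)
    (A : Type v) [AddCommGroup A] (n : ℕ) : (Simplex U n → A) →+ (Simplex V n → A) where
  toFun c σ := c (σ.map hf)
  map_zero' := rfl
  map_add' _ _ := rfl

theorem cochainMap_coboundary {U V : OpenCover X} {f : V.sets → U.sets} (hf : IsSimplicial f)
    (n : ℕ) (c : Simplex U n → A) :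
    cochainMap hf A (n + 1) (coboundary U A n c) = coboundary V A n (cochainMap hf A n c) :=
  rfl

/-- Pullback of cocycles. -/
def cocycleMap {U V : OpenCover X} {f : V.sets → U.sets} (hf : IsSimplicial f)
    (A : Type v) [AddCommGroup A] (n : ℕ) : cocycles U A n →+ cocycles V A n :=
  ((cochainMap hf A n).comp (cocycles U A n).subtype).codRestrict (cocycles V A n) (by
    intro c
    have hc : coboundary U A n c.1 = 0 := c.2
    change coboundary V A n (cochainMap hf A n c.1) = 0
    rw [← cochainMap_coboundary, hc, map_zero])

/-- The map induced on the cohomology of nerves by a simplicial map. -/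
def cohomologyMap {U V : OpenCover X} {f : V.sets → U.sets} (hf : IsSimplicial f)
    (A : Type v) [AddCommGroup A] (n : ℕ) : NerveCohomology U A n →+ NerveCohomology V A n :=
  QuotientAddGroup.map _ _ (cocycleMap hf A n) (by
    intro c hc
    rw [AddSubgroup.mem_addSubgroupOf] at hc
    rw [AddSubgroup.mem_comap, AddSubgroup.mem_addSubgroupOf]
    change cochainMap hf A n c.1 ∈ coboundaries V A n
    cases n with
    | zero =>
      have h0 : c.1 = 0 := hc
      rw [h0, map_zero]
      exact AddSubgroup.zero_mem _
    | succ n =>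
      obtain ⟨b, hb⟩ := hc
      exact ⟨cochainMap hf A n b, by rw [← cochainMap_coboundary, hb]⟩)

/-- Contiguous simplicial maps induce the same map on cohomology. -/
theorem cohomologyMap_eq_of_contiguous {U V : OpenCover X} {f g : V.sets → U.sets}
    (hf : IsSimplicial f) (hg : IsSimplicial g)
    (hfg : ∀ x : X, ∃ y : X, ∀ v : V.sets, x ∈ v.1 → y ∈ (f v).1 ∧ y ∈ (g v).1)
    (n : ℕ) : cohomologyMap hf A n = cohomologyMap hg A n := by
  classical
  ext ⟨c, hc⟩
  change (QuotientAddGroup.mk (cocycleMap hf A n ⟨c, hc⟩) : NerveCohomology V A n) =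
    QuotientAddGroup.mk (cocycleMap hg A n ⟨c, hc⟩)
  rw [QuotientAddGroup.eq, AddSubgroup.mem_addSubgroupOf]
  change -(cochainMap hf A n c) + cochainMap hg A n c ∈ coboundaries V A n
  have hc' : coboundary U A n c = 0 := hc
  let e : (Fin (n + 1) → U.sets) → A :=
    fun τ => if h : ∃ x : X, ∀ i, x ∈ (τ i).1 then c ⟨τ, h⟩ else 0
  have he : ∀ σ : Simplex U n, e σ.1 = c σ := fun σ => dif_pos σ.2
  have hde : ∀ τ : Simplex U (n + 1), tupleD e τ.1 = 0 := by
    intro τ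
    have h := congrFun hc' τ
    simp only [coboundary, AddMonoidHom.coe_mk, ZeroHom.coe_mk, ← he] at h
    exact h
  have hprism : ∀ σ : Simplex V n, tuplePrism f g (tupleD e) σ.1 = 0 := by
    rintro ⟨σ, x, hx⟩
    refine tuplePrism_eq_zero f g _ _ fun τ hτ => ?_
    obtain ⟨y, hy⟩ := hfg x
    refine hde ⟨τ, y, fun i => ?_⟩
    obtain ⟨j, hj | hj⟩ := hτ i
    · rw [hj]
      exact (hy _ (hx j)).1
    · rw [hj]
      exact (hy _ (hx j)).2
  have key : ∀ σ : Simplex V n, tupleD (tuplePrism f g e) σ.1 =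
      (-(cochainMap hf A n c) + cochainMap hg A n c) σ := by
    intro σ
    have h := tuplePrism_homotopy f g e σ.1
    rw [hprism, add_zero] at h
    rw [h, neg_add_eq_sub, Pi.sub_apply]
    exact congrArg₂ (· - ·) (he (σ.map hg)) (he (σ.map hf))
  cases n with
  | zero =>
    change _ = _
    funext σ
    rw [← key, tupleD_zero _ Fin.elim0]
    rfl
  | succ n =>
    exact ⟨fun σ => tuplePrism f g e σ.1, funext fun σ => key σ⟩

/-! ### The direct limit over refinements -/

/-- A choice, for each member of a finer cover, of a member of the coarser cover containing it. -/
noncomputable def refinement {U V : OpenCover X} (h : U ≤ V) (v : V.sets) : U.sets :=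
  (h v).choose

theorem le_refinement {U V : OpenCover X} (h : U ≤ V) (v : V.sets) :
    v.1 ≤ (refinement h v).1 :=
  (h v).choose_spec

theorem isSimplicial_of_le {U V : OpenCover X} {f : V.sets → U.sets}
    (hf : ∀ v, v.1 ≤ (f v).1) : IsSimplicial f :=
  fun x => ⟨x, fun v hx => hf v hx⟩

/-- The map `H^n(N(U); A) → H^n(N(V); A)` for a cover `V` refining `U`; it does not depend on the
choice of the refinement map, see `refineMap_eq`. -/
noncomputable def refineMap (A : Type v) [AddCommGroup A] (n : ℕ) (U V : OpenCover X)
    (h : U ≤ V) : NerveCohomology U A n →+ NerveCohomology V A n :=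
  cohomologyMap (isSimplicial_of_le (le_refinement h)) A n

theorem refineMap_eq (n : ℕ) {U V : OpenCover X} (h : U ≤ V) {f : V.sets → U.sets}
    (hf : ∀ v, v.1 ≤ (f v).1) :
    refineMap A n U V h = cohomologyMap (isSimplicial_of_le hf) A n :=
  cohomologyMap_eq_of_contiguous _ _
    (fun x => ⟨x, fun v hx => ⟨le_refinement h v hx, hf v hx⟩⟩) n

instance (n : ℕ) : DirectedSystem (fun U : OpenCover X => NerveCohomology U A n)
    (fun U V h => refineMap A n U V h) where
  map_self U c := by
    rw [refineMap_eq n le_rfl (f := id) (fun v => le_rfl)]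
    obtain ⟨c, rfl⟩ := QuotientAddGroup.mk_surjective c
    rfl
  map_map U V W h₁ h₂ c := by
    rw [refineMap_eq n (h₁.trans h₂) (f := fun w => refinement h₁ (refinement h₂ w))
      (fun w => (le_refinement h₂ w).trans (le_refinement h₁ _))]
    obtain ⟨c, rfl⟩ := QuotientAddGroup.mk_surjective c
    rfl

end

open Classical in
/-- The Čech cohomology group `H^n(X; A)`: the direct limit of the cohomology groups of the nerves
of the open covers of `X`. -/
abbrev CechCohomology (X : Type u) [TopologicalSpace X] (A : Type v) [AddCommGroup A] (n : ℕ) :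
    Type (max u v) :=
  AddCommGroup.DirectLimit (fun U : OpenCover X => NerveCohomology U A n)
    (fun U V h => refineMap A n U V h)

end Cech

/-! The maximal ideal space of `AP_Σ` is contractible, and Čech cohomology of a contractible compact
Hausdorff space vanishes in positive degrees.

For `0 ≤ s ≤ 1` there is a contractive endomorphism `damp s` of `AP_Σ` with `e_l ↦ s ^ l e_l`. Since
`Σ ⊆ [0, ∞)`, an almost periodic polynomial with spectrum in `Σ` extends to a bounded holomorphic
function on the upper half-plane. For `s > 0` damping translates it by `-log s` in the imaginary
direction, and the norm bound is the Phragmén-Lindelöf principle (`norm_sum_rpow_mul_exp_le`). At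
`s = 1` this is the identity. At `s = 0` it is the projection on the constant term, after which all characters agree
(`character_damp_zero`). Hence `(s, φ) ↦ φ ∘ damp s` contracts the space of characters to a point
(`contractibleSpace_apMaximalIdealSpace`).

Given an open cover `U` of a compact space and a contraction, the Lebesgue number lemma yields a
finer cover `V` and a subdivision of the time interval such that each product of a member of `V`
with a piece of the interval is mapped into one member of `U`
(`Cech.exists_cover_subdividing_homotopy`). Choosing these members gives one vertex map from `V` to
`U` for each piece. The maps of neighbouring pieces are contiguous, the first map is a refinement
map, and the last is contiguous to a constant map, which is zero on cohomology in positive degrees.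
So every class on the nerve of `U` dies on the nerve of `V` (`Cech.exists_refineMap_eq_zero`). -/

/-! ### Čech cohomology of contractible compact spaces -/

namespace Cech

universe u v

section

variable {X : Type u} [TopologicalSpace X] {A : Type v} [AddCommGroup A]

/-- A constant vertex map factors through the nerve of a point, so it vanishes in positive
degrees. -/
theorem cohomologyMap_const {U V : OpenCover X} (k : U.sets)
    (hk : IsSimplicial fun _ : V.sets => k) (n : ℕ) :
    cohomologyMap hk A (n + 1) = 0 := by
  ext ⟨c, hc⟩
  change (QuotientAddGroup.mk (cocycleMap hk A (n + 1) ⟨c, hc⟩) : NerveCohomology V A (n + 1)) = 0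
  rw [QuotientAddGroup.eq_zero_iff, AddSubgroup.mem_addSubgroupOf]
  change cochainMap hk A (n + 1) c ∈ (coboundary V A n).range
  by_cases h : ∃ x, x ∈ k.1
  · let s : ∀ j, Simplex U j := fun j => ⟨fun _ => k, h.imp fun _ hx _ => hx⟩
    refine ⟨fun _ => c (s (n + 1)), funext fun σ => ?_⟩
    -- The pullback of `c` is constant. Its value, as a constant cochain one degree lower, has
    -- coboundary the same constant if `n + 2` is odd and zero if `n + 2` is even; in the latter case
    -- the cocycle condition at the degenerate simplex `(k, …, k)` says that the value is zero.
    have h0 : ∑ i : Fin (n + 3), (-1 : ℤ) ^ (i : ℕ) • c (s (n + 1)) = 0 :=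
      congrFun (show coboundary U A (n + 1) c = 0 from hc) (s (n + 2))
    change ∑ i : Fin (n + 2), (-1 : ℤ) ^ (i : ℕ) • c (s (n + 1)) = c (s (n + 1))
    rw [← Finset.sum_smul, Fin.sum_neg_one_pow] at h0 ⊢
    by_cases hn : Even (n + 2)
    · rw [if_neg (by rw [Nat.even_add_one]; exact not_not.2 hn), one_smul] at h0
      rw [h0, smul_zero]
    · rw [if_neg hn, one_smul]
  · refine ⟨0, funext fun σ => (h ?_).elim⟩
    obtain ⟨x, hx⟩ := (σ.map hk).2
    exact ⟨x, hx 0⟩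

/-- A homotopy on a compact space can be subdivided in time, uniformly over a fine enough cover,
so that every piece stays inside one member of a given cover. -/
theorem exists_cover_subdividing_homotopy [CompactSpace X] [T2Space X] (H : C(unitInterval × X, X))
    (U : OpenCover X) : ∃ (V : OpenCover X) (N : ℕ) (f : ℕ → V.sets → U.sets),
      ∀ i ≤ N, ∀ v : V.sets, ∀ x ∈ v.1, ∀ t : unitInterval,
        (i : ℝ) / (N + 1) ≤ t → (t : ℝ) ≤ (i + 1) / (N + 1) → H (t, x) ∈ (f i v).1 := by
  let : UniformSpace X := uniformSpaceOfCompactR1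
  obtain ⟨W, hW, hWU⟩ := lebesgue_number_lemma (isCompact_univ (X := unitInterval × X))
    (U := fun u : U.sets => H ⁻¹' (u.1 : Set X)) (fun u => u.1.isOpen.preimage H.continuous)
    (fun p _ => by
      obtain ⟨u, hu, hp⟩ := U.exists_mem (H p)
      exact Set.mem_iUnion.2 ⟨⟨u, hu⟩, hp⟩)
  rw [uniformity_prod_eq_prod, mem_map, mem_prod_iff] at hW
  obtain ⟨R, hR, E, hE, hRE⟩ := hW
  obtain ⟨ε, hε, hεR⟩ := Metric.mem_uniformity_dist.1 hR
  obtain ⟨N, hN⟩ := exists_nat_one_div_lt hε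
  let V : OpenCover X :=
    { sets := {v | ∃ x, (v : Set X) ⊆ UniformSpace.ball x E}
      exists_mem := fun x => ⟨⟨interior (UniformSpace.ball x E), isOpen_interior⟩,
        ⟨x, interior_subset⟩, mem_interior_iff_mem_nhds.2 (UniformSpace.ball_mem_nhds x hE)⟩ }
  have hex : ∀ (i : ℕ) (v : V.sets), ∃ u : U.sets, ∀ x ∈ v.1, i ≤ N → ∀ t : unitInterval,
      (i : ℝ) / (N + 1) ≤ t → (t : ℝ) ≤ (i + 1) / (N + 1) → H (t, x) ∈ u.1 := by
    rintro i ⟨v, x₀, hv⟩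
    have hNpos : (0 : ℝ) < N + 1 := by positivity
    by_cases hi : i ≤ N
    · obtain ⟨u, hu⟩ := hWU (⟨i / (N + 1), by positivity, by
        rw [div_le_one hNpos]
        exact_mod_cast hi.trans (Nat.le_succ N)⟩, x₀) (Set.mem_univ _)
      refine ⟨u, fun x hx _ t h₁ h₂ => hu (hRE (Set.mk_mem_prod (hεR ?_) (hv hx)))⟩
      rw [Subtype.dist_eq, Real.dist_eq, abs_sub_comm, abs_of_nonneg (sub_nonneg.2 h₁)]
      rw [add_div] at h₂
      linarith
    · obtain ⟨u, hu, -⟩ := U.exists_mem x₀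
      exact ⟨⟨u, hu⟩, fun _ _ h => (hi h).elim⟩
  choose f hf using hex
  exact ⟨V, N, f, fun i hi v x hx t => hf i v x hx hi t⟩

/-- Every class on the nerve of a cover of a contractible compact space dies on a refinement. The
vertex maps belonging to consecutive time steps of a contraction are contiguous; the first one is a
refinement map and the last one is contiguous to a constant map. -/
theorem exists_refineMap_eq_zero [CompactSpace X] [T2Space X] [ContractibleSpace X]
    (U : OpenCover X) (n : ℕ) :
    ∃ (V : OpenCover X) (h : U ≤ V), refineMap A (n + 1) U V h = 0 := by
  obtain ⟨p, ⟨H⟩⟩ := id_nullhomotopic X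
  obtain ⟨V, N, f, hf⟩ := exists_cover_subdividing_homotopy H.toContinuousMap U
  have hNpos : (0 : ℝ) < N + 1 := by positivity
  have hf0 : ∀ v : V.sets, v.1 ≤ (f 0 v).1 := by
    intro v x hx
    have h := hf 0 (Nat.zero_le N) v x hx 0 (by simp) (by simpa using by positivity)
    simpa using h
  have hfN : ∀ v : V.sets, ∀ x ∈ v.1, p ∈ (f N v).1 := by
    intro v x hx
    have h := hf N le_rfl v x hx 1
      (by rw [Set.Icc.coe_one, div_le_one hNpos]; linarith) (by
        rw [Set.Icc.coe_one, div_self hNpos.ne'])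
    simpa using h
  have hsimp : ∀ i ≤ N, IsSimplicial (f i) := by
    intro i hi x
    refine ⟨H (⟨i / (N + 1), by positivity, by
      rw [div_le_one hNpos]
      exact_mod_cast hi.trans (Nat.le_succ N)⟩, x), fun v hx => hf i hi v x hx _ le_rfl ?_⟩
    change (i : ℝ) / (N + 1) ≤ (i + 1) / (N + 1)
    gcongr
    linarith
  have hstep : ∀ i (hi : i ≤ N), cohomologyMap (hsimp i hi) A (n + 1) =
      cohomologyMap (hsimp 0 (Nat.zero_le N)) A (n + 1) := by
    intro i
    induction i with
    | zero => exact fun _ => rfl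
    | succ i ih =>
      intro hi
      rw [← ih (Nat.le_of_succ_le hi)]
      refine cohomologyMap_eq_of_contiguous _ _ (fun x => ?_) _
      let t : unitInterval := ⟨((i + 1 : ℕ) : ℝ) / (N + 1), by positivity, by
        rw [div_le_one hNpos]
        exact_mod_cast hi.trans (Nat.le_succ N)⟩
      refine ⟨H (t, x), fun v hx => ⟨hf (i + 1) hi v x hx t le_rfl ?_,
        hf i (Nat.le_of_succ_le hi) v x hx t ?_ ?_⟩⟩
      · change ((i + 1 : ℕ) : ℝ) / (N + 1) ≤ (((i + 1 : ℕ) : ℝ) + 1) / (N + 1)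
        gcongr
        linarith
      · change (i : ℝ) / (N + 1) ≤ ((i + 1 : ℕ) : ℝ) / (N + 1)
        gcongr
        linarith
      · exact (by push_cast; rfl : ((i + 1 : ℕ) : ℝ) / (N + 1) = (i + 1) / (N + 1)).le
  obtain ⟨u, hu, hpu⟩ := U.exists_mem p
  have hk : IsSimplicial fun _ : V.sets => (⟨u, hu⟩ : U.sets) := fun _ => ⟨p, fun _ _ => hpu⟩
  refine ⟨V, fun v => ⟨f 0 v, hf0 v⟩, ?_⟩
  rw [refineMap_eq (n + 1) _ hf0, ← cohomologyMap_const (⟨u, hu⟩ : U.sets) hk n,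
    ← cohomologyMap_eq_of_contiguous (hsimp N le_rfl) hk
      (fun x => ⟨p, fun v hx => ⟨hfN v x hx, hpu⟩⟩) (n + 1), hstep N le_rfl]

theorem subsingleton_cechCohomology [CompactSpace X] [T2Space X] [ContractibleSpace X] {m : ℕ}
    (hm : 1 ≤ m) : Subsingleton (CechCohomology X A m) := by
  classical
  obtain ⟨n, rfl⟩ := Nat.exists_eq_add_of_le' hm
  refine subsingleton_of_forall_eq 0 fun z => ?_
  induction z using AddCommGroup.DirectLimit.induction_on with
  | ih U c =>
    obtain ⟨V, h, hV⟩ := exists_refineMap_eq_zero (A := A) U n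
    rw [← AddCommGroup.DirectLimit.of_f (f := fun U V h => refineMap A (n + 1) U V h) h c, hV,
      AddMonoidHom.zero_apply, map_zero]

end

end Cech

/-! ### The damping semigroup on `AP_Σ` -/

theorem apExp_mem_apAlgebra {S : AddSubmonoid ℝ} {l : ℝ} (hl : l ∈ S) : apExp l ∈ apAlgebra S := by
  refine subset_closure ?_
  change apExp l ∈ apPolynomialsOn S
  rw [apPolynomialsOn_eq_span]
  exact Submodule.subset_span ⟨l, hl, rfl⟩

/-- Damping contracts: for a finite sum `∑ r_l e_l` with `l ≥ 0`, multiplying the coefficients by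
`s ^ l` with `0 < s ≤ 1` amounts to evaluating the bounded holomorphic extension to the upper
half-plane at height `-log s`, and the Phragmén-Lindelöf principle applies. The case `s = 0` is the
limit of these. -/
theorem norm_sum_rpow_mul_exp_le {S : AddSubmonoid ℝ} (hS : ∀ l ∈ S, 0 ≤ l) (f : S →₀ ℂ) {C : ℝ}
    (hC : ∀ x : ℝ, ‖f.sum fun l r => r * Complex.exp (Complex.I * (l : ℝ) * x)‖ ≤ C)
    {s : ℝ} (hs : s ∈ Set.Icc (0 : ℝ) 1) (x : ℝ) :
    ‖f.sum fun l r => r * ((s ^ (l : ℝ) : ℝ) * Complex.exp (Complex.I * (l : ℝ) * x))‖ ≤ C := by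
  have hpos : ∀ s ∈ Set.Ioc (0 : ℝ) 1,
      ‖f.sum fun l r => r * ((s ^ (l : ℝ) : ℝ) * Complex.exp (Complex.I * (l : ℝ) * x))‖ ≤ C := by
    intro s hs
    -- The upper half-plane is rotated to the right one: `F z` is the extension at the point `i z`.
    let F : ℂ → ℂ := fun z => f.sum fun l r => r * Complex.exp (-(l : ℝ) * z)
    have hF : Differentiable ℂ F := by
      unfold F Finsupp.sum
      fun_prop
    have hbound : ∀ z : ℂ, 0 ≤ z.re → ‖F z‖ ≤ f.sum fun _ r => ‖r‖ := by
      intro z hz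
      refine (norm_sum_le _ _).trans (Finset.sum_le_sum fun l _ => ?_)
      rw [norm_mul, Complex.norm_exp]
      refine mul_le_of_le_one_right (norm_nonneg _) (Real.exp_le_one_iff.2 ?_)
      simpa using mul_nonneg (hS l l.2) hz
    have key : ‖F ((-Real.log s : ℝ) - x * Complex.I)‖ ≤ C := by
      refine PhragmenLindelof.right_half_plane_of_bounded_on_real hF.diffContOnCl
        ⟨0, two_pos, 0, ?_⟩ ?_ ?_ ?_
      · refine Asymptotics.IsBigO.of_bound (f.sum fun _ r => ‖r‖) ?_
        filter_upwards [mem_inf_of_right (mem_principal_self _)] with z hz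
        simpa using hbound z (le_of_lt hz)
      · refine ⟨f.sum fun _ r => ‖r‖, eventually_map.2 ?_⟩
        filter_upwards [eventually_ge_atTop 0] with y hy
        exact hbound y (by simpa using hy)
      · intro y
        refine le_of_eq_of_le (congrArg norm ?_) (hC (-y))
        refine Finset.sum_congr rfl fun l _ => ?_
        dsimp only
        congr 2
        push_cast
        ring
      · simpa using Real.log_nonpos hs.1.le hs.2
    convert key using 2
    refine Finset.sum_congr rfl fun l _ => ?_
    dsimp only
    rw [Real.rpow_def_of_pos hs.1, Complex.ofReal_exp, ← Complex.exp_add]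
    congr 2
    push_cast
    ring
  rcases hs.1.eq_or_lt with rfl | h0
  · have hcont : Continuous fun s : ℝ =>
        ‖f.sum fun l r => r * ((s ^ (l : ℝ) : ℝ) * Complex.exp (Complex.I * (l : ℝ) * x))‖ := by
      unfold Finsupp.sum
      refine (continuous_finsetSum _ fun l _ => continuous_const.mul ?_).norm
      exact (Complex.continuous_ofReal.comp (Real.continuous_rpow_const (hS l l.2))).mul
        continuous_const
    refine le_of_tendsto (hcont.continuousWithinAt (s := Set.Ioi 0)) ?_
    filter_upwards [Ioc_mem_nhdsGT one_pos] with s hs using hpos s hs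
  · exact hpos s ⟨h0, hs.2⟩

/-- The homomorphism from the semigroup algebra of `Σ` to `AP_Σ` which sends the generator `l` to
`s ^ l e_l`. The convention `0 ^ 0 = 1` makes it unital for `s = 0` too, and for `s = 1` it is the
evaluation of formal sums as almost periodic polynomials. -/
noncomputable def dampedPolynomial {S : AddSubmonoid ℝ} (hS : ∀ l ∈ S, 0 ≤ l) (s : unitInterval) :
    AddMonoidAlgebra ℂ S →ₐ[ℂ] apAlgebra S :=
  AddMonoidAlgebra.lift ℂ (apAlgebra S) S
    { toFun := fun l => (((s : ℝ) ^ (l.toAdd : ℝ) : ℝ) : ℂ) • ⟨apExp l.toAdd,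
        apExp_mem_apAlgebra l.toAdd.2⟩
      map_one' := by
        ext x
        simp
      map_mul' := fun k l => by
        ext1
        change _ • apExp ((k.toAdd : ℝ) + l.toAdd) = (_ • apExp k.toAdd) * (_ • apExp l.toAdd)
        rw [smul_mul_smul_comm, apExp_mul, ← Complex.ofReal_mul,
          ← Real.rpow_add_of_nonneg s.2.1 (hS _ k.toAdd.2) (hS _ l.toAdd.2)]
        rfl }

section

variable {S : AddSubmonoid ℝ} (hS : ∀ l ∈ S, 0 ≤ l)

theorem dampedPolynomial_single (s : unitInterval) (l : S) (r : ℂ) :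
    dampedPolynomial hS s (AddMonoidAlgebra.single l r) =
      r • (((s : ℝ) ^ (l : ℝ) : ℝ) : ℂ) • ⟨apExp l, apExp_mem_apAlgebra l.2⟩ :=
  AddMonoidAlgebra.lift_single _ _ _

theorem dampedPolynomial_apply (s : unitInterval) (p : AddMonoidAlgebra ℂ S) (x : ℝ) :
    (dampedPolynomial hS s p : ℝ →ᵇ ℂ) x = p.coeff.sum fun l r =>
      r * (((s : ℝ) ^ (l : ℝ) : ℝ) * Complex.exp (Complex.I * (l : ℝ) * x)) := by
  induction p using AddMonoidAlgebra.induction_linear with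
  | zero => simp
  | add p q hp hq =>
    rw [map_add, AddMonoidAlgebra.coeff_add, Finsupp.sum_add_index' (by simp)
      (by intros; ring), ← hp, ← hq]
    rfl
  | single l r =>
    rw [dampedPolynomial_single, AddMonoidAlgebra.coeff_single, Finsupp.sum_single_index (by simp)]
    rfl

theorem norm_dampedPolynomial_le (s : unitInterval) (p : AddMonoidAlgebra ℂ S) :
    ‖dampedPolynomial hS s p‖ ≤ ‖dampedPolynomial hS 1 p‖ := by
  change ‖(dampedPolynomial hS s p : ℝ →ᵇ ℂ)‖ ≤ ‖(dampedPolynomial hS 1 p : ℝ →ᵇ ℂ)‖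
  refine (BoundedContinuousFunction.norm_le (norm_nonneg _)).2 fun x => ?_
  rw [dampedPolynomial_apply]
  refine norm_sum_rpow_mul_exp_le hS _ (fun y => ?_) s.2 x
  have h := (dampedPolynomial hS 1 p : ℝ →ᵇ ℂ).norm_coe_le_norm y
  rw [dampedPolynomial_apply] at h
  simpa only [Set.Icc.coe_one, Real.one_rpow, Complex.ofReal_one, one_mul] using h

theorem denseRange_dampedPolynomial_one : DenseRange (dampedPolynomial hS 1) := by
  intro a
  rw [closure_subtype]
  refine closure_mono (fun b hb => ?_) a.2
  change b ∈ apPolynomialsOn S at hb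
  rw [apPolynomialsOn_eq_span] at hb
  suffices h : Submodule.span ℂ (apExp '' (S : Set ℝ)) ≤ LinearMap.range
      ((apAlgebra S).val.toLinearMap ∘ₗ (dampedPolynomial hS 1).toLinearMap) by
    obtain ⟨p, hp⟩ := h hb
    exact ⟨_, ⟨p, rfl⟩, hp⟩
  rw [Submodule.span_le]
  rintro _ ⟨l, hl, rfl⟩
  refine ⟨AddMonoidAlgebra.single ⟨l, hl⟩ 1, ?_⟩
  change ((dampedPolynomial hS 1 _ : apAlgebra S) : ℝ →ᵇ ℂ) = _
  simp [dampedPolynomial_single]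

instance : NormOneClass (apAlgebra S) :=
  ⟨norm_one (α := ℝ →ᵇ ℂ)⟩

instance : CompleteSpace (apAlgebra S) :=
  (apPolynomialAlgebra S).isClosed_topologicalClosure.completeSpace_coe

/-- The continuous linear operator on `AP_Σ` which multiplies the Bohr-Fourier coefficient at `l`
by `s ^ l`. -/
noncomputable def dampCLM (s : unitInterval) : apAlgebra S →L[ℂ] apAlgebra S :=
  (dampedPolynomial hS s).toLinearMap.extendOfNorm (dampedPolynomial hS 1).toLinearMap

theorem dampCLM_dampedPolynomial (s : unitInterval) (p : AddMonoidAlgebra ℂ S) :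
    dampCLM hS s (dampedPolynomial hS 1 p) = dampedPolynomial hS s p :=
  LinearMap.extendOfNorm_eq (denseRange_dampedPolynomial_one hS)
    ⟨1, fun p => (norm_dampedPolynomial_le hS s p).trans_eq (one_mul _).symm⟩ p

/-- The endomorphism of `AP_Σ` with `e_l ↦ s ^ l e_l`. -/
noncomputable def damp (s : unitInterval) : apAlgebra S →ₐ[ℂ] apAlgebra S :=
  AlgHom.ofLinearMap (dampCLM hS s).toLinearMap
    (by
      have h := dampCLM_dampedPolynomial hS s 1
      rwa [map_one (dampedPolynomial hS 1), map_one (dampedPolynomial hS s)] at h)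
    (by
      intro a b
      refine (denseRange_dampedPolynomial_one hS).induction_on₂
        (p := fun a b => dampCLM hS s (a * b) = dampCLM hS s a * dampCLM hS s b)
        (isClosed_eq (by fun_prop) (by fun_prop)) (fun p q => ?_) a b
      rw [← map_mul, dampCLM_dampedPolynomial, dampCLM_dampedPolynomial, dampCLM_dampedPolynomial,
        map_mul])

theorem damp_dampedPolynomial (s : unitInterval) (p : AddMonoidAlgebra ℂ S) :
    damp hS s (dampedPolynomial hS 1 p) = dampedPolynomial hS s p :=
  dampCLM_dampedPolynomial hS s p

theorem continuous_damp (s : unitInterval) : Continuous (damp hS s) :=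
  (dampCLM hS s).continuous

theorem norm_damp_le (s : unitInterval) (a : apAlgebra S) : ‖damp hS s a‖ ≤ ‖a‖ := by
  refine (denseRange_dampedPolynomial_one hS).induction_on (p := fun a => ‖damp hS s a‖ ≤ ‖a‖) a
    (isClosed_le (continuous_damp hS s).norm continuous_norm) fun p => ?_
  rw [damp_dampedPolynomial]
  exact norm_dampedPolynomial_le hS s p

theorem damp_one (a : apAlgebra S) : damp hS 1 a = a := by
  refine (denseRange_dampedPolynomial_one hS).induction_on (p := fun a => damp hS 1 a = a) a
    (isClosed_eq (continuous_damp hS 1) continuous_id) fun p => ?_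
  rw [damp_dampedPolynomial]

/-- `damp hS 0` sends a function to the constant Bohr-Fourier mean of it, on which all characters
agree. -/
theorem character_damp_zero (φ ψ : apMaximalIdealSpace S) (a : apAlgebra S) :
    φ (damp hS 0 a) = ψ (damp hS 0 a) := by
  refine (denseRange_dampedPolynomial_one hS).induction_on
    (p := fun a => φ (damp hS 0 a) = ψ (damp hS 0 a)) a
    (isClosed_eq ((map_continuous φ).comp (continuous_damp hS 0))
      ((map_continuous ψ).comp (continuous_damp hS 0))) fun p => ?_
  rw [damp_dampedPolynomial]
  induction p using AddMonoidAlgebra.induction_linear with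
  | zero => simp
  | add p q hp hq => rw [map_add, map_add, map_add, hp, hq]
  | single l r =>
    rw [dampedPolynomial_single]
    by_cases hl : (l : ℝ) = 0
    · have h1 : (⟨apExp l, apExp_mem_apAlgebra l.2⟩ : apAlgebra S) = 1 :=
        Subtype.ext ((congrArg apExp hl).trans apExp_zero)
      rw [h1]
      simp only [map_smul, map_one]
    · simp [Real.zero_rpow hl]

/-! ### Contracting the maximal ideal space -/

/-- The character `e_l ↦ s ^ l φ(e_l)`. -/
noncomputable def dampCharacter (s : unitInterval) (φ : apMaximalIdealSpace S) :
    apMaximalIdealSpace S :=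
  WeakDual.CharacterSpace.equivAlgHom.symm
    ((WeakDual.CharacterSpace.equivAlgHom φ).comp (damp hS s))

theorem dampCharacter_apply (s : unitInterval) (φ : apMaximalIdealSpace S) (a : apAlgebra S) :
    dampCharacter hS s φ a = φ (damp hS s a) :=
  rfl

/-- The coordinate of `dampCharacter` at a polynomial is a finite sum of jointly continuous
functions `s ^ l φ(e_l)`; the others are uniform limits of these. -/
theorem continuous_dampCharacter :
    Continuous fun q : unitInterval × apMaximalIdealSpace S => dampCharacter hS q.1 q.2 := by
  refine Continuous.subtype_mk (WeakDual.continuous_of_continuous_eval fun a => ?_) _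
  change Continuous fun q : unitInterval × apMaximalIdealSpace S => q.2 (damp hS q.1 a)
  have hpoly : ∀ p : AddMonoidAlgebra ℂ S, Continuous
      fun q : unitInterval × apMaximalIdealSpace S => q.2 (dampedPolynomial hS q.1 p) := by
    intro p
    induction p using AddMonoidAlgebra.induction_linear with
    | zero => simpa using continuous_const
    | add p p' hp hp' =>
      simp only [map_add]
      exact hp.add hp'
    | single l r =>
      simp only [dampedPolynomial_single, map_smul, smul_eq_mul]
      refine continuous_const.mul (Continuous.mul ?_ ?_)
      · exact Complex.continuous_ofReal.comp ((Real.continuous_rpow_const (hS l l.2)).comp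
          (continuous_subtype_val.comp continuous_fst))
      · exact (WeakDual.eval_continuous _).comp (continuous_subtype_val.comp continuous_snd)
  refine continuous_of_uniform_approx_of_continuous fun W hW => ?_
  obtain ⟨ε, hε, hεW⟩ := Metric.mem_uniformity_dist.1 hW
  obtain ⟨p, hp⟩ := (denseRange_dampedPolynomial_one hS).exists_dist_lt a hε
  refine ⟨_, hpoly p, fun q => hεW ?_⟩
  rw [← damp_dampedPolynomial, dist_eq_norm, ← map_sub, ← map_sub]
  refine lt_of_le_of_lt ?_ (dist_eq_norm a _ ▸ hp)
  exact (AlgHom.norm_apply_le_self q.2 _).trans (norm_damp_le hS q.1 _)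

theorem contractibleSpace_apMaximalIdealSpace (hS : ∀ l ∈ S, 0 ≤ l) :
    ContractibleSpace (apMaximalIdealSpace S) := by
  let ev : apAlgebra S →ₐ[ℂ] ℂ :=
    { toFun := fun a => (a : ℝ →ᵇ ℂ) 0
      map_one' := rfl
      map_mul' := fun _ _ => rfl
      map_zero' := rfl
      map_add' := fun _ _ => rfl
      commutes' := fun r => by simp [Algebra.algebraMap_eq_smul_one] }
  let φ₀ : apMaximalIdealSpace S := WeakDual.CharacterSpace.equivAlgHom.symm ev
  rw [contractible_iff_id_nullhomotopic]
  refine ⟨dampCharacter hS 0 φ₀, ContinuousMap.Homotopic.symm ⟨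
    { toFun := fun q => dampCharacter hS q.1 q.2
      continuous_toFun := continuous_dampCharacter hS
      map_zero_left := fun φ => ?_
      map_one_left := fun φ => ?_ }⟩⟩
  · ext a
    exact character_damp_zero hS φ φ₀ a
  · ext a
    exact congrArg φ (damp_one hS a)

end

theorem corollary1 (S : AddSubmonoid ℝ) (hS : ∀ l ∈ S, 0 ≤ l) (m : ℕ) (hm : 1 ≤ m) :
    Subsingleton (Cech.CechCohomology (apMaximalIdealSpace S) ℤ m) := by
  have := contractibleSpace_apMaximalIdealSpace hS
  exact Cech.subsingleton_cechCohomology hm
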